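/- Let $K$ be a field and let $E=(E^0,E^1,s,r)$ be a finite directed graph (loops and parallel edges allowed): $E^0$ (vertices) and $E^1$ (edges) are finite sets and $s,r:E^1\to E^0$ are the source and range maps. The Leavitt path algebra $L_K(E)$ is the $K$-algebra generated by the symbols $v$ ($v\in E^0$) and $e,e^*$ ($e\in E^1$) subject to the relations $vu=\delta_{v,u}v$ for $v,u\in E^0$; $s(e)e=er(e)=e$ and $r(e)e^*=e^*s(e)=e^*$ for $e\in E^1$; $e^*f=\delta_{e,f}r(e)$ for $e,f\in E^1$; and $v=\sum_{e\in E^1,\,s(e)=v}ee^*$ for every $v\in E^0$ with $s^{-1}(v)\neq\emptyset$. It is unital with $1=\sum_{v\in E^0}v$. A cycle in $E$ is a sequence of edges $c=e_1e_2\cdots e_n$ ($n\ge 1$) with $r(e_i)=s(e_{i+1})$ for $1\le i<n$, $r(e_n)=s(e_1)$, and $s(e_1),\dots,s(e_n)$ pairwise distinct; an exit for $c$ is an edge $f$ such that $s(f)=s(e_i)$ and $f\neq e_i$ for some $i$. A ring $R$ is a principal ideal ring if every left ideal of $R$ has the form $Rt$ and every right ideal of $R$ has the form $tR$, for some $t\in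 R$. Then $L_K(E)$ is a principal ideal ring if and only if no cycle in $E$ has an exit. Moreover, if some cycle in $E$ has an exit, then there is an infinite sequence $(\psi_i)_{i\in\mathbb N}$ of nonzero idempotents of $L_K(E)$ with $\psi_i\psi_j=0$ for $i\ne j$, such that the left ideal $\sum_{i} L_K(E)\psi_i$ is not finitely generated. -/

import Mathlib

universe u v w

/-- A directed graph `(E⁰, E¹, s, r)` with vertex set `V = E⁰` and edge set `E = E¹`;
loops and parallel edges are allowed. -/
structure DirectedGraph (V : Type u) (E : Type v) where
  /-- the source vertex `s(e)` of an edge -/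
  s : E → V
  /-- the range vertex `r(e)` of an edge -/
  r : E → V

namespace DirectedGraph

/-- A cycle: a path `e₁ e₂ ⋯ eₙ` with `n ≥ 1` edges, that is `r(eᵢ) = s(eᵢ₊₁)`, which is closed,
`r(eₙ) = s(e₁)`, and whose vertices `s(e₁), …, s(eₙ)` are pairwise distinct. -/
structure IsCycle {V : Type u} {E : Type v} (G : DirectedGraph V E) (c : List E) : Prop where
  ne_nil : c ≠ []
  isChain : c.IsChain (fun e f => G.r e = G.s f)
  closed : G.r (c.getLast ne_nil) = G.s (c.head ne_nil)
  nodup : (c.map G.s).Nodup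

/-- An exit for `c = e₁ ⋯ eₙ` is an edge `f` with `s(f) = s(eᵢ)` and `f ≠ eᵢ` for some `i`. -/
def HasExit {V : Type u} {E : Type v} (G : DirectedGraph V E) (c : List E) : Prop :=
  ∃ e ∈ c, ∃ f : E, G.s f = G.s e ∧ f ≠ e

end DirectedGraph

/-- The generators of the Leavitt path algebra: the vertices `v`, the edges `e`, and the ghost
edges `e*`. -/
inductive LeavittGenerator (V : Type u) (E : Type v) : Type (max u v)
  | vertex (x : V) : LeavittGenerator V E
  | edge (e : E) : LeavittGenerator V E
  | ghost (e : E) : LeavittGenerator V E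

namespace LeavittGenerator

/-- The vertex `x` in the free `K`-algebra on the generators. -/
abbrev fv (K : Type w) [Field K] {V : Type u} (E : Type v) (x : V) :
    FreeAlgebra K (LeavittGenerator V E) := FreeAlgebra.ι K (vertex x)

/-- The edge `e` in the free `K`-algebra on the generators. -/
abbrev fe (K : Type w) [Field K] (V : Type u) {E : Type v} (e : E) :
    FreeAlgebra K (LeavittGenerator V E) := FreeAlgebra.ι K (edge e)

/-- The ghost edge `e*` in the free `K`-algebra on the generators. -/
abbrev fg (K : Type w) [Field K] (V : Type u) {E : Type v} (e : E) :
    FreeAlgebra K (LeavittGenerator V E) := FreeAlgebra.ι K (ghost e)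

end LeavittGenerator

open LeavittGenerator in
/-- The defining relations of the Leavitt path algebra of a graph with finitely many vertices.
The relation `one` says that the unit is the sum of the vertices: by (V), (E1) and (E2) this sum is
a two-sided unit on all generators, so the unital algebra presented here is the algebra
presented, without reference to a unit, by the other relations. -/
inductive LeavittRel (K : Type w) [Field K] {V : Type u} {E : Type v} [Fintype V]
    (G : DirectedGraph V E) :
    FreeAlgebra K (LeavittGenerator V E) → FreeAlgebra K (LeavittGenerator V E) → Prop
  -- (V)
  | vertex_self (x : V) : LeavittRel K G (fv K E x * fv K E x) (fv K E x)
  | vertex_ne (x y : V) (h : x ≠ y) : LeavittRel K G (fv K E x * fv K E y) 0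
  -- (E1)
  | source_edge (e : E) : LeavittRel K G (fv K E (G.s e) * fe K V e) (fe K V e)
  | edge_range (e : E) : LeavittRel K G (fe K V e * fv K E (G.r e)) (fe K V e)
  -- (E2)
  | range_ghost (e : E) : LeavittRel K G (fv K E (G.r e) * fg K V e) (fg K V e)
  | ghost_source (e : E) : LeavittRel K G (fg K V e * fv K E (G.s e)) (fg K V e)
  -- (CK1)
  | ck1_self (e : E) : LeavittRel K G (fg K V e * fe K V e) (fv K E (G.r e))
  | ck1_ne (e f : E) (h : e ≠ f) : LeavittRel K G (fg K V e * fe K V f) 0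
  -- (CK2), for every vertex `x` whose set `A` of outgoing edges is finite and nonempty
  | ck2 (x : V) (A : Finset E) (hA : ∀ e, e ∈ A ↔ G.s e = x) (hne : A.Nonempty) :
      LeavittRel K G (fv K E x) (∑ e ∈ A, fe K V e * fg K V e)
  -- the unit is the sum of all vertices
  | one : LeavittRel K G 1 (∑ x : V, fv K E x)

/-- The Leavitt path algebra `L_K(E)` of a graph with finitely many vertices. -/
abbrev LeavittPathAlgebra (K : Type w) [Field K] {V : Type u} {E : Type v} [Fintype V]
    (G : DirectedGraph V E) : Type (max u v w) :=
  RingQuot (LeavittRel K G)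

/-- A (not necessarily commutative) ring in which every one-sided ideal is principal: every left
ideal is of the form `R t` and every right ideal is of the form `t R`. -/
structure IsLeftRightPIR (R : Type u) [Ring R] : Prop where
  left : ∀ I : Submodule R R, I.IsPrincipal
  right : ∀ I : Submodule Rᵐᵒᵖ R, I.IsPrincipal

/-! If no cycle has an exit, every cyclic vertex emits a single edge, and these edges permute the
cyclic vertices. Their sum, completed by the noncyclic vertices, is a unit `u` that permutes the
vertices by conjugation (`nonempty_rotation`). Call a vertex terminal if it is cyclic or a sink.
Between terminal vertices `x`, `y` the corner is spanned by the elements `x uⁿ y`. It vanishes for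
different orbits, and for `x = y` it is a quotient of `K[T;T⁻¹]`. Expanding nonterminal vertices by
(CK2), which stops because the graph is finite, gives matrix units for `1` whose diagonal
idempotents represent the orbits. The algebra is thus a finite product of matrix rings over
quotients of a principal ideal domain. `IsLeftRightPIR.of_corners` concludes from the matrix units
alone, without computing these quotients.

Conversely, let `e` lie on a cycle and let `f ≠ e` leave the same vertex `x`. The closed path `α`
through `e` and its ghost `β` satisfy `βα = x`, while `f*(x - αβ)f = r(f)` is nonzero. As for a
one-sided shift, the `αⁱ(x - αβ)βⁱ` are nonzero orthogonal idempotents, and infinitely many of these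
never generate a finitely generated left ideal. That vertices do not vanish is seen in an explicit
representation (`vert_ne_zero`). -/

/-! ### Principal one-sided ideals from matrix units -/

section PrincipalCriterion

open scoped LaurentPolynomial

/-- Laurent polynomials are a localization of `K[X]`, so each ideal is extended from a principal
one. -/
instance LaurentPolynomial.isPrincipalIdealRing (K : Type*) [Field K] :
    IsPrincipalIdealRing K[T;T⁻¹] where
  principal I := by
    rw [← IsLocalization.map_under (Submonoid.powers (Polynomial.X : Polynomial K)) K[T;T⁻¹] I]
    exact Submodule.IsPrincipal.map_ringHom _ (IsPrincipalIdealRing.principal _)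

/-- Over a principal ideal domain, a submodule of a module with generators indexed by `ι` again
has generators indexed by `ι`. -/
theorem Submodule.exists_eq_span_range_of_le_span_range {A M ι : Type*} [CommRing A] [IsDomain A]
    [IsPrincipalIdealRing A] [AddCommGroup M] [Module A M] [Finite ι] (b : ι → M)
    (N : Submodule A M) (hN : N ≤ span A (Set.range b)) :
    ∃ y : ι → M, N = span A (Set.range y) := by
  classical
  have := Fintype.ofFinite ι
  set g := Fintype.linearCombination A b
  obtain ⟨n, S⟩ := (N.comap g).smithNormalForm (Pi.basisFun A ι)
  have hmap : (N.comap g).map g = N := by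
    rw [map_comap_eq, Fintype.range_linearCombination, inf_eq_right.2 hN]
  -- The Smith basis may have fewer elements than `ι`; the indices outside the image of `S.f`
  -- receive `0`.
  refine ⟨Function.extend S.f (fun k => g (S.bN k)) 0, ?_⟩
  have hspan : span A (Set.range fun k => g (S.bN k)) = N := by
    have h := congrArg (Submodule.map (g ∘ₗ (N.comap g).subtype)) S.bN.span_eq
    rw [Submodule.map_span, Submodule.map_top, LinearMap.range_comp, Submodule.range_subtype, hmap,
      ← Set.range_comp] at h
    exact h
  refine le_antisymm ?_ (span_le.2 ?_)
  · conv_lhs => rw [← hspan]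
    refine span_mono ?_
    rintro _ ⟨k, rfl⟩
    exact ⟨S.f k, S.f.injective.extend_apply _ _ _⟩
  · rintro _ ⟨i, rfl⟩
    by_cases hi : ∃ k, S.f k = i
    · obtain ⟨k, rfl⟩ := hi
      rw [S.f.injective.extend_apply]
      exact (S.bN k).2
    · rw [Function.extend_apply' _ _ _ hi]
      exact N.zero_mem

/-- A ring with a full family of matrix units, whose diagonal corners are images of a principal
ideal domain `A` and whose remaining corners vanish, has only principal left ideals. -/
theorem Submodule.isPrincipal_of_corners {A R ι W : Type*} [CommRing A] [IsDomain A]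
    [IsPrincipalIdealRing A] [Ring R] [Fintype ι] [DecidableEq ι] (a b : ι → R) (τ : ι → W)
    (ε : W → R) (φ : W → A →+* R) (hsum : ∑ i, a i * b i = 1)
    (hba : ∀ i j, b i * a j = if i = j then ε (τ i) else 0)
    (hεb : ∀ i, ε (τ i) * b i = b i) (hcomm : ∀ w f, φ w f * ε w = ε w * φ w f)
    (hcorner : ∀ w x, ∃ f, ε w * x * ε w = φ w f * ε w)
    (horth : ∀ w w' x, w ≠ w' → ε w * x * ε w' = 0) (I : Submodule R R) : I.IsPrincipal := by
  classical
  have key : ∀ w, ∃ y : {i // τ i = w} → R, (∀ i, y i ∈ I ∧ ε w * y i = y i) ∧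
      ∀ x ∈ I, ε w * x = x → x ∈ Submodule.span R (Set.range y) := by
    intro w
    -- The image of `φ w` need not be central; `A` acts on `R` by left multiplication, and `hcomm`
    -- makes `ε w * I` stable.
    let _ : Module A R := Module.compHom R (φ w)
    have hsmul : ∀ (f : A) (x : R), f • x = φ w f * x := fun _ _ => rfl
    let N : Submodule A R :=
      { carrier := {x | x ∈ I ∧ ε w * x = x}
        add_mem' := fun hx hy => ⟨I.add_mem hx.1 hy.1, by rw [mul_add, hx.2, hy.2]⟩
        zero_mem' := ⟨I.zero_mem, mul_zero _⟩
        smul_mem' := fun f x hx => ⟨I.smul_mem (φ w f) hx.1, by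
          rw [hsmul, ← mul_assoc, ← hcomm, mul_assoc, hx.2]⟩ }
    obtain ⟨y, hy⟩ := N.exists_eq_span_range_of_le_span_range
      (fun i : {i // τ i = w} => b i) (by
        intro x hx
        rw [← mul_one x, ← hsum, Finset.mul_sum]
        refine Submodule.sum_mem _ fun i _ => ?_
        -- In `x = ∑ (x aᵢ) bᵢ` each coefficient may be cut down to the corner from `w` to `τ i`.
        -- This is zero unless `τ i = w`, and otherwise it acts as a scalar from `A`.
        have hi : x * (a i * b i) = ε w * (x * a i) * ε (τ i) * b i := by
          rw [mul_assoc _ (ε _), hεb, ← mul_assoc (ε w), hx.2, mul_assoc]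
        rw [hi]
        by_cases h : τ i = w
        · obtain ⟨f, hf⟩ := hcorner w (x * a i)
          rw [h, hf, mul_assoc, ← h, hεb]
          subst h
          exact Submodule.smul_mem _ f (Submodule.subset_span ⟨⟨i, rfl⟩, rfl⟩)
        · rw [horth _ _ _ (Ne.symm h), zero_mul]
          exact Submodule.zero_mem _)
    refine ⟨y, fun i => ?_, fun x hx hwx => ?_⟩
    · have : y i ∈ N := hy ▸ Submodule.subset_span ⟨i, rfl⟩
      exact this
    · have hxN : x ∈ N := ⟨hx, hwx⟩
      rw [hy] at hxN
      clear hx hwx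
      induction hxN using Submodule.span_induction with
      | mem x h => exact Submodule.subset_span h
      | zero => exact Submodule.zero_mem _
      | add x z _ _ hx hz => exact Submodule.add_mem _ hx hz
      | smul f x _ hx => exact Submodule.smul_mem _ (φ w f) hx
  choose y hy hspan using key
  -- There is exactly one generator `y` per matrix unit, so all of them fit into one element, from
  -- which `b i` recovers the `i`-th.
  set t : R := ∑ i, a i * y (τ i) ⟨i, rfl⟩ with ht
  have hbt : ∀ i, b i * t = y (τ i) ⟨i, rfl⟩ := by
    intro i
    rw [ht, Finset.mul_sum, Finset.sum_eq_single i, ← mul_assoc, hba, if_pos rfl, (hy _ _).2]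
    · intro j _ hj
      rw [← mul_assoc, hba, if_neg (Ne.symm hj), zero_mul]
    · simp
  refine ⟨t, le_antisymm (fun x hx => ?_) ?_⟩
  · rw [← one_mul x, ← hsum, Finset.sum_mul]
    refine Submodule.sum_mem _ fun i _ => ?_
    rw [mul_assoc]
    refine Submodule.smul_mem _ (a i) ?_
    have hle : Submodule.span R (Set.range (y (τ i))) ≤ Submodule.span R {t} := by
      rw [Submodule.span_le]
      rintro _ ⟨⟨j, hj⟩, rfl⟩
      have : y (τ i) ⟨j, hj⟩ = b j * t := by
        rw [hbt]
        generalize τ i = w at hj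
        subst hj
        rfl
      rw [this]
      exact Submodule.smul_mem _ (b j) (Submodule.mem_span_singleton_self t)
    exact hle (hspan _ _ (I.smul_mem (b i) hx) (by rw [← mul_assoc, hεb]))
  · rw [Submodule.span_le, Set.singleton_subset_iff]
    exact Submodule.sum_mem _ fun i _ => I.smul_mem (a i) (hy _ _).1

/-- The two-sided form of `Submodule.isPrincipal_of_corners`. -/
theorem IsLeftRightPIR.of_corners {A ι W : Type*} {R : Type u} [CommRing A] [IsDomain A]
    [IsPrincipalIdealRing A] [Ring R] [Fintype ι] [DecidableEq ι] (a b : ι → R) (τ : ι → W)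
    (ε : W → R) (φ : W → A →+* R) (hsum : ∑ i, a i * b i = 1)
    (hba : ∀ i j, b i * a j = if i = j then ε (τ i) else 0)
    (hεb : ∀ i, ε (τ i) * b i = b i) (haε : ∀ i, a i * ε (τ i) = a i)
    (hcomm : ∀ w f, φ w f * ε w = ε w * φ w f)
    (hcorner : ∀ w x, ∃ f, ε w * x * ε w = φ w f * ε w)
    (horth : ∀ w w' x, w ≠ w' → ε w * x * ε w' = 0) : IsLeftRightPIR R where
  left := Submodule.isPrincipal_of_corners a b τ ε φ hsum hba hεb hcomm hcorner horth
  right I := by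
    let Φ : R ≃ₗ[Rᵐᵒᵖ] Rᵐᵒᵖ :=
      { MulOpposite.opAddEquiv with map_smul' := fun _ _ => rfl }
    -- The hypotheses are self-dual: passing to the opposite ring exchanges `a` and `b`, and `φ w`
    -- survives because `A` is commutative.
    have h : (I.map Φ.toLinearMap).IsPrincipal :=
      Submodule.isPrincipal_of_corners (A := A)
        (fun i => MulOpposite.op (b i)) (fun i => MulOpposite.op (a i)) τ
        (fun w => MulOpposite.op (ε w))
        (fun w => (φ w).toOpposite fun f g => by
          rw [commute_iff_eq, ← map_mul, ← map_mul, mul_comm])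
        (by rw [← MulOpposite.op_one, ← hsum, Finset.op_sum]; rfl)
        (fun i j => by
          rw [← MulOpposite.op_mul, hba]
          split_ifs with h1 h2 h2
          · rw [h1]
          · exact absurd h1.symm h2
          · exact absurd h2.symm h1
          · rfl)
        (fun i => by rw [← MulOpposite.op_mul, haε])
        (fun w f => congrArg MulOpposite.op (hcomm w f).symm)
        (fun w x => by
          obtain ⟨f, hf⟩ := hcorner w x.unop
          rw [hcomm, mul_assoc] at hf
          exact ⟨f, congrArg MulOpposite.op hf⟩)
        (fun w w' x hw => by
          have := congrArg MulOpposite.op (horth w' w x.unop (Ne.symm hw))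
          rw [mul_assoc] at this
          exact this) _
    obtain ⟨t, ht⟩ := h
    refine ⟨t.unop, ?_⟩
    apply Submodule.map_injective_of_injective Φ.injective
    rw [ht, Submodule.map_span, Set.image_singleton]
    rfl

end PrincipalCriterion

/-! ### Orthogonal idempotents -/

/-- Finitely many of the `ψ i` would already generate. For `n` not among their indices, the left
annihilator of `ψ n` contains all of them but not `ψ n`. -/
theorem Ideal.not_fg_span_range_of_orthogonalIdempotents {R : Type*} [Ring R] {ψ : ℕ → R}
    (hψ : OrthogonalIdempotents ψ) (hne : ∀ i, ψ i ≠ 0) : ¬ (Ideal.span (Set.range ψ)).FG := by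
  classical
  intro h
  obtain ⟨s, hs, hspan⟩ := (Submodule.fg_span_iff_fg_span_finset_subset (R := R) _).1 h
  obtain ⟨t, ht⟩ : ∃ t : Finset ℕ, (s : Set R) ⊆ ψ '' t := by
    rw [← Set.image_univ] at hs
    obtain ⟨t, -, ht⟩ := Finset.subset_set_image_iff.1 hs
    exact ⟨t, by rw [← ht]; simp⟩
  obtain ⟨n, hn⟩ := Infinite.exists_notMem_finset t
  have hle : Submodule.span R (s : Set R) ≤ LinearMap.ker (LinearMap.toSpanSingleton R R (ψ n)) := by
    rw [Submodule.span_le]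
    intro x hx
    obtain ⟨m, hm, rfl⟩ := ht hx
    exact hψ.ortho fun h => hn (h ▸ hm)
  have hmem : ψ n ∈ Submodule.span R (s : Set R) := hspan ▸ Submodule.subset_span ⟨n, rfl⟩
  exact hne n ((hψ.idem n).symm.trans (hle hmem))

/-- The idempotents `αⁱ (x - αβ) βⁱ` attached to `α`, `β` with `βα = x`. -/
theorem orthogonalIdempotents_pow_mul_sub_mul_pow {R : Type*} [Ring R] {x α β : R}
    (hβα : β * α = x) (hxα : x * α = α) (hαx : α * x = α) (hβx : β * x = β) (hxβ : x * β = β) :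
    OrthogonalIdempotents (fun i : ℕ => α ^ i * (x - α * β) * β ^ i) ∧
      ∀ i : ℕ, β ^ i * (α ^ i * (x - α * β) * β ^ i) * α ^ i = x - α * β := by
  have hxx : x * x = x := by
    conv_lhs => rw [← hβα, mul_assoc, hβα, hαx]
    exact hβα
  set p := x - α * β with hp
  have hxp : x * p = p := by rw [hp, mul_sub, hxx, ← mul_assoc, hxα]
  have hpx : p * x = p := by rw [hp, sub_mul, hxx, mul_assoc, hβx]
  have hpα : p * α = 0 := by rw [hp, sub_mul, mul_assoc, hβα, hxα, hαx, sub_self]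
  have hβp : β * p = 0 := by rw [hp, mul_sub, ← mul_assoc, hβα, hxβ, hβx, sub_self]
  have hpp : p * p = p := by
    conv_lhs => rw [hp, sub_mul, mul_assoc, hβp, mul_zero, sub_zero, hxp]
  -- The zeroth powers are `1`, not `x`, so exponent `0` is treated separately in `hl` and `hr`.
  have hpow : ∀ i : ℕ, β ^ (i + 1) * α ^ (i + 1) = x := by
    intro i
    induction i with
    | zero => rw [zero_add, pow_one, pow_one, hβα]
    | succ i ih =>
      rw [pow_succ β, pow_succ' α (i + 1), mul_assoc, ← mul_assoc β, hβα, pow_succ' α i,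
        ← mul_assoc x, hxα, ← pow_succ', ih]
  have hl : ∀ i, p * (β ^ i * α ^ i) = p := by
    rintro (_ | i)
    · simp
    · rw [hpow, hpx]
  have hr : ∀ i, (β ^ i * α ^ i) * p = p := by
    rintro (_ | i)
    · simp
    · rw [hpow, hxp]
  -- For different exponents a surplus `α` or `β` remains next to `p` and is killed by `pα = 0` or
  -- `βp = 0`.
  have hlt : ∀ i k : ℕ, p * (β ^ i * α ^ (i + (k + 1))) = 0 := fun i k => by
    rw [pow_add, ← mul_assoc (β ^ i), ← mul_assoc, hl, pow_succ', ← mul_assoc, hpα, zero_mul]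
  have hgt : ∀ i k : ℕ, (β ^ (i + (k + 1)) * α ^ i) * p = 0 := fun i k => by
    rw [add_comm, pow_add, mul_assoc (β ^ (k + 1)), mul_assoc, hr, pow_succ, mul_assoc, hβp,
      mul_zero]
  have hmul : ∀ i j, (α ^ i * p * β ^ i) * (α ^ j * p * β ^ j) =
      α ^ i * (p * (β ^ i * α ^ j) * p) * β ^ j := fun i j => by simp only [mul_assoc]
  refine ⟨⟨fun i => ?_, fun i j hij => ?_⟩, fun i => ?_⟩
  · rw [IsIdempotentElem, hmul, hl, hpp]
  · change (α ^ i * p * β ^ i) * (α ^ j * p * β ^ j) = 0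
    rw [hmul]
    rcases Nat.lt_or_gt_of_ne hij with h | h
    · obtain ⟨k, rfl⟩ := Nat.exists_eq_add_of_lt h
      rw [add_assoc, hlt, zero_mul, mul_zero, zero_mul]
    · obtain ⟨k, rfl⟩ := Nat.exists_eq_add_of_lt h
      rw [add_assoc, mul_assoc p, hgt, mul_zero, mul_zero, zero_mul]
  · rw [← mul_assoc, ← mul_assoc, hr, mul_assoc, hl]

/-! ### Walks, cycles and cyclic vertices -/

namespace DirectedGraph

variable {V : Type u} {E : Type v} (G : DirectedGraph V E)

/-- There is an edge from `x` to `y`. -/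
def Adj (x y : V) : Prop := ∃ e, G.s e = x ∧ G.r e = y

/-- `G.IsWalk x l y`: the edges in `l` form a walk from `x` to `y`. -/
def IsWalk : V → List E → V → Prop
  | x, [], y => x = y
  | x, e :: l, y => G.s e = x ∧ IsWalk (G.r e) l y

variable {G}

theorem adj_s_r (e : E) : G.Adj (G.s e) (G.r e) := ⟨e, rfl, rfl⟩

theorem isWalk_append {x y : V} {l₁ l₂ : List E} :
    G.IsWalk x (l₁ ++ l₂) y ↔ ∃ z, G.IsWalk x l₁ z ∧ G.IsWalk z l₂ y := by
  induction l₁ generalizing x with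
  | nil => simp [IsWalk]
  | cons e l ih => simp [IsWalk, ih, and_assoc]

theorem IsWalk.reflTransGen {x y : V} {l : List E} (h : G.IsWalk x l y) :
    Relation.ReflTransGen G.Adj x y := by
  induction l generalizing x with
  | nil => exact h ▸ .refl
  | cons e l ih =>
    obtain ⟨rfl, h⟩ := h
    exact .head (adj_s_r e) (ih h)

theorem exists_isWalk_of_reflTransGen {x y : V} (h : Relation.ReflTransGen G.Adj x y) :
    ∃ l, G.IsWalk x l y := by
  induction h using Relation.ReflTransGen.head_induction_on with
  | refl => exact ⟨[], rfl⟩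
  | head h _ ih =>
    obtain ⟨e, rfl, rfl⟩ := h
    obtain ⟨l, hl⟩ := ih
    exact ⟨e :: l, rfl, hl⟩

theorem isWalk_of_isChain {e : E} {l : List E}
    (h : (e :: l).IsChain fun e f => G.r e = G.s f) :
    G.IsWalk (G.s e) (e :: l) (G.r ((e :: l).getLast (List.cons_ne_nil e l))) := by
  induction l generalizing e with
  | nil => exact ⟨rfl, rfl⟩
  | cons f l ih =>
    rw [List.isChain_cons_cons] at h
    refine ⟨rfl, ?_⟩
    rw [h.1, List.getLast_cons (List.cons_ne_nil f l)]
    exact ih h.2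

theorem IsWalk.isChain {x y : V} {l : List E} (h : G.IsWalk x l y) :
    l.IsChain fun e f => G.r e = G.s f := by
  induction l generalizing x with
  | nil => exact .nil
  | cons e l ih =>
    obtain ⟨-, h⟩ := h
    cases l with
    | nil => exact .singleton e
    | cons f l => exact List.isChain_cons_cons.2 ⟨h.1.symm, ih h⟩

theorem IsWalk.r_getLast {x y : V} {l : List E} (h : G.IsWalk x l y) (hl : l ≠ []) :
    G.r (l.getLast hl) = y := by
  induction l generalizing x with
  | nil => exact absurd rfl hl
  | cons e l ih =>
    obtain ⟨-, h⟩ := h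
    cases l with
    | nil => exact h
    | cons f l =>
      rw [List.getLast_cons (List.cons_ne_nil f l)]
      exact ih h _

/-- From any edge of a cycle one gets back to its source. -/
theorem IsCycle.reflTransGen {c : List E} (hc : G.IsCycle c) {e : E} (he : e ∈ c) :
    Relation.ReflTransGen G.Adj (G.r e) (G.s e) := by
  obtain ⟨hne, hchain, hclosed, -⟩ := hc
  cases c with
  | nil => exact absurd rfl hne
  | cons a l =>
    have hw := isWalk_of_isChain hchain
    rw [hclosed, List.head_cons] at hw
    obtain ⟨l₁, l₂, hl⟩ := List.append_of_mem he
    rw [hl, isWalk_append] at hw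
    obtain ⟨z, h₁, rfl, h₂⟩ := hw
    exact h₂.reflTransGen.trans h₁.reflTransGen

theorem exists_append_of_not_nodup_map {α β : Type*} (f : α → β) {l : List α}
    (h : ¬ (l.map f).Nodup) :
    ∃ l₁ a l₂ b l₃, l = l₁ ++ a :: (l₂ ++ b :: l₃) ∧ f a = f b := by
  induction l with
  | nil => simp at h
  | cons x l ih =>
    rw [List.map_cons, List.nodup_cons, not_and_or, not_not, List.mem_map] at h
    rcases h with ⟨b, hb, hfb⟩ | h
    · obtain ⟨l₂, l₃, rfl⟩ := List.append_of_mem hb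
      exact ⟨[], x, l₂, b, l₃, rfl, hfb.symm⟩
    · obtain ⟨l₁, a, l₂, b, l₃, rfl, hab⟩ := ih h
      exact ⟨x :: l₁, a, l₂, b, l₃, rfl, hab⟩

/-- A closed walk at `x` contains a cycle through `x`. -/
theorem IsWalk.exists_isCycle {x : V} {l : List E} (h : G.IsWalk x l x) (hl : l ≠ []) :
    ∃ c, G.IsCycle c ∧ ∃ e ∈ c, G.s e = x := by
  induction hn : l.length using Nat.strong_induction_on generalizing l with
  | _ n ih =>
    subst hn
    by_cases hd : (l.map G.s).Nodup
    · cases l with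
      | nil => exact absurd rfl hl
      | cons e l =>
        refine ⟨e :: l, ⟨hl, h.isChain, ?_, hd⟩, e, List.mem_cons_self, h.1⟩
        rw [h.r_getLast]
        exact h.1.symm
    · obtain ⟨l₁, a, l₂, b, l₃, rfl, hab⟩ := exists_append_of_not_nodup_map _ hd
      rw [isWalk_append] at h
      obtain ⟨z, h₁, h₂⟩ := h
      rw [← List.cons_append, isWalk_append] at h₂
      obtain ⟨z', h₂, h₃⟩ := h₂
      have hz : z = z' := by rw [← h₂.1, ← h₃.1, hab]
      -- The loop between two edges with equal source is cut out, rather than kept, so that the walk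
      -- stays based at `x`.
      refine ih (l₁ ++ b :: l₃).length ?_ (isWalk_append.2 ⟨z, h₁, hz ▸ h₃⟩) (by simp) rfl
      simp only [List.length_append, List.length_cons]
      omega

variable (G) in
/-- A vertex is cyclic if some nonempty closed walk passes through it. -/
def IsCyclic (x : V) : Prop := Relation.TransGen G.Adj x x

variable (G) in
/-- Every cyclic vertex emits exactly one edge. -/
def NoExit : Prop := ∀ e f, G.IsCyclic (G.s e) → G.s f = G.s e → f = e

/-- A closed walk at a vertex can be shortened to a cycle through it; any edge there other than the
one on the cycle would be an exit. -/
theorem noExit_of_forall_isCycle (h : ∀ c : List E, G.IsCycle c → ¬ G.HasExit c) :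
    G.NoExit := by
  have key : ∀ x, G.IsCyclic x → ∃ e₀, ∀ f, G.s f = x → f = e₀ := by
    intro x hx
    obtain ⟨_, ⟨e, rfl, rfl⟩, hy⟩ := Relation.TransGen.head'_iff.1 hx
    obtain ⟨l, hl⟩ := exists_isWalk_of_reflTransGen hy
    have hw : G.IsWalk (G.s e) (e :: l) (G.s e) := ⟨rfl, hl⟩
    obtain ⟨c, hc, e₀, he₀, hs⟩ := hw.exists_isCycle (List.cons_ne_nil e l)
    refine ⟨e₀, fun f hf => ?_⟩
    by_contra hne
    exact h c hc ⟨e₀, he₀, f, hf.trans hs.symm, hne⟩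
  intro e f he hf
  obtain ⟨e₀, h₀⟩ := key _ he
  rw [h₀ f hf, h₀ e rfl]

/-- If cyclic vertices emit only one edge, these edges permute the cyclic vertices. -/
theorem NoExit.exists_perm [Finite V] (h : G.NoExit) :
    ∃ (ε : {x // G.IsCyclic x} → E) (π : Equiv.Perm {x // G.IsCyclic x}),
      (∀ x, G.s (ε x) = x) ∧ (∀ x, G.r (ε x) = π x) := by
  have hex : ∀ x : {x // G.IsCyclic x}, ∃ e, G.s e = x ∧ G.IsCyclic (G.r e) := by
    rintro ⟨x, hx⟩
    obtain ⟨_, ⟨e, rfl, rfl⟩, hy⟩ := Relation.TransGen.head'_iff.1 hx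
    exact ⟨e, rfl, Relation.TransGen.tail' hy (adj_s_r e)⟩
  choose ε hs hr using hex
  -- By finiteness surjectivity suffices. The last edge of a closed walk through `y` starts at a
  -- cyclic vertex, hence is the edge chosen there.
  have hsurj : Function.Surjective
      fun x => (⟨G.r (ε x), hr x⟩ : {x // G.IsCyclic x}) := by
    rintro ⟨y, hy⟩
    obtain ⟨x, hyx, e, rfl, rfl⟩ := Relation.TransGen.tail'_iff.1 hy
    have hx : G.IsCyclic (G.s e) := .head' (adj_s_r e) hyx
    refine ⟨⟨G.s e, hx⟩, Subtype.ext ?_⟩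
    exact congrArg G.r (h _ _ hx (hs ⟨G.s e, hx⟩))
  exact ⟨ε, .ofBijective _ ⟨Finite.injective_iff_surjective.2 hsurj, hsurj⟩, hs, fun x => rfl⟩

/-- The edges starting at noncyclic vertices form a well-founded relation. -/
theorem wellFounded_adj_of_not_isCyclic [Finite V] :
    WellFounded fun y x => ¬ G.IsCyclic x ∧ G.Adj x y := by
  set Q : V → V → Prop := fun y x => ¬ G.IsCyclic x ∧ G.Adj x y
  have hirr : Std.Irrefl (Relation.TransGen Q) := ⟨fun x hx => by
    have hcyc : G.IsCyclic x := by
      exact Relation.TransGen.mono (r := Function.swap Q) (fun a b hab => hab.2) _ _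
        (Relation.transGen_swap.2 hx)
    obtain ⟨y, -, hy⟩ := Relation.TransGen.tail'_iff.1 hx
    exact hy.1 hcyc⟩
  exact (Finite.wellFounded_of_trans_of_irrefl (Relation.TransGen Q)).mono
    fun _ _ h => Relation.TransGen.single h

end DirectedGraph

/-! ### Computing with the generators -/

namespace LeavittPathAlgebra

section Generators

variable (K : Type w) [Field K] {V : Type u} {E : Type v} [Fintype V] (G : DirectedGraph V E)

/-- The vertex `x` in the Leavitt path algebra. -/
def vert (x : V) : LeavittPathAlgebra K G :=
  RingQuot.mkAlgHom K (LeavittRel K G) (LeavittGenerator.fv K E x)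

/-- The edge `e` in the Leavitt path algebra. -/
def edge (e : E) : LeavittPathAlgebra K G :=
  RingQuot.mkAlgHom K (LeavittRel K G) (LeavittGenerator.fe K V e)

/-- The ghost edge `e*` in the Leavitt path algebra. -/
def ghost (e : E) : LeavittPathAlgebra K G :=
  RingQuot.mkAlgHom K (LeavittRel K G) (LeavittGenerator.fg K V e)

variable {K G}

theorem vert_mul_self (x : V) : vert K G x * vert K G x = vert K G x := by
  rw [vert, ← map_mul]
  exact RingQuot.mkAlgHom_rel K (.vertex_self x)

theorem vert_mul_of_ne {x y : V} (h : x ≠ y) : vert K G x * vert K G y = 0 := by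
  rw [vert, vert, ← map_mul, RingQuot.mkAlgHom_rel K (.vertex_ne x y h), map_zero]

theorem vert_mul_edge (e : E) : vert K G (G.s e) * edge K G e = edge K G e := by
  rw [vert, edge, ← map_mul, RingQuot.mkAlgHom_rel K (.source_edge e)]

theorem edge_mul_vert (e : E) : edge K G e * vert K G (G.r e) = edge K G e := by
  rw [vert, edge, ← map_mul, RingQuot.mkAlgHom_rel K (.edge_range e)]

theorem vert_mul_ghost (e : E) : vert K G (G.r e) * ghost K G e = ghost K G e := by
  rw [vert, ghost, ← map_mul, RingQuot.mkAlgHom_rel K (.range_ghost e)]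

theorem ghost_mul_vert (e : E) : ghost K G e * vert K G (G.s e) = ghost K G e := by
  rw [vert, ghost, ← map_mul, RingQuot.mkAlgHom_rel K (.ghost_source e)]

theorem ghost_mul_edge_self (e : E) : ghost K G e * edge K G e = vert K G (G.r e) := by
  rw [vert, ghost, edge, ← map_mul, RingQuot.mkAlgHom_rel K (.ck1_self e)]

theorem ghost_mul_edge_of_ne {e f : E} (h : e ≠ f) : ghost K G e * edge K G f = 0 := by
  rw [ghost, edge, ← map_mul, RingQuot.mkAlgHom_rel K (.ck1_ne e f h), map_zero]

theorem vert_eq_sum (x : V) (A : Finset E) (hA : ∀ e, e ∈ A ↔ G.s e = x) (hne : A.Nonempty) :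
    vert K G x = ∑ e ∈ A, edge K G e * ghost K G e := by
  rw [vert, RingQuot.mkAlgHom_rel K (.ck2 x A hA hne), map_sum]
  simp only [map_mul, edge, ghost]

variable (K G) in
theorem one_eq_sum_vert : (1 : LeavittPathAlgebra K G) = ∑ x, vert K G x := by
  have h := RingQuot.mkAlgHom_rel K (LeavittRel.one (K := K) (G := G))
  rw [map_one, map_sum] at h
  exact h

theorem vert_mul_edge_of_ne {x : V} {e : E} (h : G.s e ≠ x) : vert K G x * edge K G e = 0 := by
  rw [← vert_mul_edge, ← mul_assoc, vert_mul_of_ne h.symm, zero_mul]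

theorem edge_mul_vert_of_ne {x : V} {e : E} (h : G.r e ≠ x) : edge K G e * vert K G x = 0 := by
  rw [← edge_mul_vert, mul_assoc, vert_mul_of_ne h, mul_zero]

theorem ghost_mul_vert_of_ne {x : V} {e : E} (h : G.s e ≠ x) : ghost K G e * vert K G x = 0 := by
  rw [← ghost_mul_vert, mul_assoc, vert_mul_of_ne h, mul_zero]

/-- A subspace stable under right multiplication by the generators is a right ideal. -/
theorem mul_mem_of_forall_generator (W : Submodule K (LeavittPathAlgebra K G))
    (hv : ∀ y ∈ W, ∀ x, y * vert K G x ∈ W) (he : ∀ y ∈ W, ∀ e, y * edge K G e ∈ W)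
    (hg : ∀ y ∈ W, ∀ e, y * ghost K G e ∈ W) {y : LeavittPathAlgebra K G} (hy : y ∈ W)
    (a : LeavittPathAlgebra K G) : y * a ∈ W := by
  obtain ⟨a, rfl⟩ := RingQuot.mkAlgHom_surjective K (LeavittRel K G) a
  induction a using FreeAlgebra.induction generalizing y with
  | grade0 r =>
    rw [AlgHom.commutes, ← Algebra.commutes, ← Algebra.smul_def]
    exact W.smul_mem r hy
  | grade1 x =>
    cases x with
    | vertex x => exact hv y hy x
    | edge e => exact he y hy e
    | ghost e => exact hg y hy e
  | mul a b ha hb =>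
    rw [map_mul, ← mul_assoc]
    exact hb (ha hy)
  | add a b ha hb =>
    rw [map_add, mul_add]
    exact W.add_mem (ha hy) (hb hy)

/-- Here `a` is a path from `x` to `y` and `b` its ghost; the product `b * a` telescopes by (CK1).
-/
theorem exists_mul_eq_vert_of_reflTransGen {x y : V} (h : Relation.ReflTransGen G.Adj x y) :
    ∃ a b : LeavittPathAlgebra K G, b * a = vert K G y ∧ vert K G x * a = a ∧
      a * vert K G y = a ∧ b * vert K G x = b ∧ vert K G y * b = b := by
  induction h using Relation.ReflTransGen.head_induction_on with
  | refl => exact ⟨vert K G y, vert K G y, by simp only [vert_mul_self, and_self]⟩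
  | head h _ ih =>
    obtain ⟨e, rfl, rfl⟩ := h
    obtain ⟨a, b, hba, hxa, hay, hbx, hyb⟩ := ih
    refine ⟨edge K G e * a, b * ghost K G e, ?_, ?_, ?_, ?_, ?_⟩
    · rw [mul_assoc, ← mul_assoc (ghost K G e), ghost_mul_edge_self, hxa, hba]
    · rw [← mul_assoc, vert_mul_edge]
    · rw [mul_assoc, hay]
    · rw [mul_assoc, ghost_mul_vert]
    · rw [← mul_assoc, hyb]

end Generators

/-! ### A representation in which no vertex vanishes -/

section Representation

/-- The vertices with outgoing edges, times `ℕ`, are partitioned by the edges, times `ℕ`. -/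
theorem exists_selfSimilar {V : Type u} {E : Type v} (G : DirectedGraph V E) [Finite E] :
    ∃ p : E × ℕ → V × ℕ, Function.Injective p ∧ (∀ q, (p q).1 = G.s q.1) ∧
      ∀ z : V × ℕ, (∃ e, G.s e = z.1) → ∃ q, p q = z := by
  -- Both sides are countably infinite.
  have φ : ∀ x, Nonempty {e // G.s e = x} → ({e // G.s e = x} × ℕ ≃ ℕ) := fun x _ =>
    nonempty_equiv_of_countable.some
  let p : E × ℕ → V × ℕ := fun q => (G.s q.1, φ (G.s q.1) ⟨q.1, rfl⟩ (⟨q.1, rfl⟩, q.2))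
  have hp : ∀ x (hx : Nonempty {e // G.s e = x}) e (n : ℕ) (h : G.s e = x),
      p (e, n) = (x, φ x hx (⟨e, h⟩, n)) := by
    rintro _ hx e n rfl
    rfl
  refine ⟨p, ?_, fun q => rfl, ?_⟩
  · rintro ⟨e, n⟩ ⟨f, m⟩ h
    have hs : G.s f = G.s e := (congrArg Prod.fst h).symm
    rw [hp (G.s e) ⟨e, rfl⟩ e n rfl, hp (G.s e) ⟨e, rfl⟩ f m hs] at h
    have := (φ _ _).injective (congrArg Prod.snd h)
    simp only [Prod.mk.injEq, Subtype.mk.injEq] at this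
    exact Prod.ext this.1 this.2
  · rintro ⟨x, m⟩ ⟨e, he⟩
    set q := (φ x ⟨e, he⟩).symm m with hq
    refine ⟨(q.1, q.2), ?_⟩
    rw [hp x ⟨e, he⟩ _ _ q.1.2]
    simp [hq]

variable (K : Type w) [Field K] {V : Type u} {E : Type v} [Fintype V] (G : DirectedGraph V E)

open Classical in
/-- Every vertex of a finite graph is nonzero in the Leavitt path algebra. -/
theorem vert_ne_zero [Finite E] (x : V) : vert K G x ≠ 0 := by
  obtain ⟨p, hinj, hs, hsurj⟩ := exists_selfSimilar G
  -- A vertex restricts functions to its fibre. An edge `e` transplants the values over `r(e)` to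
  -- the piece `p (e, ·)` of the fibre over `s(e)`, with `0` elsewhere, and `e*` carries them back.
  -- (CK2) holds because the pieces exhaust the fibre of every vertex that emits an edge.
  let fv : V → Module.End K (V × ℕ → K) := fun x =>
    { toFun := fun f z => if z.1 = x then f z else 0
      map_add' := fun f g => by ext z; by_cases h : z.1 = x <;> simp [h]
      map_smul' := fun c f => by ext z; by_cases h : z.1 = x <;> simp [h] }
  let fe : E → Module.End K (V × ℕ → K) := fun e =>
    { toFun := fun f z => if h : ∃ n, p (e, n) = z then f (G.r e, h.choose) else 0
      map_add' := fun f g => by ext z; by_cases h : ∃ n, p (e, n) = z <;> simp [h]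
      map_smul' := fun c f => by ext z; by_cases h : ∃ n, p (e, n) = z <;> simp [h] }
  let fg : E → Module.End K (V × ℕ → K) := fun e =>
    { toFun := fun f z => if z.1 = G.r e then f (p (e, z.2)) else 0
      map_add' := fun f g => by ext z; by_cases h : z.1 = G.r e <;> simp [h]
      map_smul' := fun c f => by ext z; by_cases h : z.1 = G.r e <;> simp [h] }
  have fv_apply : ∀ x f z, fv x f z = if z.1 = x then f z else 0 := fun _ _ _ => rfl
  have fg_apply : ∀ e f z, fg e f z = if z.1 = G.r e then f (p (e, z.2)) else 0 :=
    fun _ _ _ => rfl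
  have fe_self : ∀ e f n, fe e f (p (e, n)) = f (G.r e, n) := by
    intro e f n
    have h : ∃ m, p (e, m) = p (e, n) := ⟨n, rfl⟩
    have hm : h.choose = n := congrArg Prod.snd (hinj h.choose_spec)
    change (if h : ∃ m, p (e, m) = p (e, n) then f (G.r e, h.choose) else 0) = _
    rw [dif_pos h, hm]
  have fe_zero : ∀ e f z, (∀ n, p (e, n) ≠ z) → fe e f z = 0 := by
    intro e f z hz
    exact dif_neg fun ⟨n, hn⟩ => hz n hn
  have fe_cases : ∀ e z, (∃ n, z = p (e, n)) ∨ ∀ n, p (e, n) ≠ z := by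
    intro e z
    by_cases h : ∃ n, p (e, n) = z
    · exact .inl (h.imp fun _ => Eq.symm)
    · exact .inr (not_exists.1 h)
  have fe_ne : ∀ e e' f n, e ≠ e' → fe e' f (p (e, n)) = 0 := fun e e' f n h =>
    fe_zero _ _ _ fun m hm => h (congrArg Prod.fst (hinj hm)).symm
  let gen : LeavittGenerator V E → Module.End K (V × ℕ → K)
    | .vertex x => fv x
    | .edge e => fe e
    | .ghost e => fg e
  have hrel : ∀ ⦃a b⦄, LeavittRel K G a b →
      FreeAlgebra.lift K gen a = FreeAlgebra.lift K gen b := by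
    intro a b h
    cases h with
    | vertex_self x =>
      simp only [map_mul, FreeAlgebra.lift_ι_apply, gen]
      ext1 f; ext z
      by_cases h : z.1 = x <;> simp [fv_apply, h]
    | vertex_ne x y h =>
      simp only [map_mul, map_zero, FreeAlgebra.lift_ι_apply, gen]
      ext1 f; ext z
      by_cases hx : z.1 = x
      · simp [fv_apply, hx, h]
      · simp [fv_apply, hx]
    | source_edge e =>
      simp only [map_mul, FreeAlgebra.lift_ι_apply, gen]
      ext1 f; ext z
      rcases fe_cases e z with ⟨n, rfl⟩ | hz
      · simp [fv_apply, hs]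
      · simp [fv_apply, fe_zero e f z hz]
    | edge_range e =>
      simp only [map_mul, FreeAlgebra.lift_ι_apply, gen]
      ext1 f; ext z
      rcases fe_cases e z with ⟨n, rfl⟩ | hz
      · simp [fv_apply, fe_self]
      · simp [fe_zero e _ z hz]
    | range_ghost e =>
      simp only [map_mul, FreeAlgebra.lift_ι_apply, gen]
      ext1 f; ext z
      by_cases h : z.1 = G.r e <;> simp [fv_apply, fg_apply, h]
    | ghost_source e =>
      simp only [map_mul, FreeAlgebra.lift_ι_apply, gen]
      ext1 f; ext z
      by_cases h : z.1 = G.r e <;> simp [fv_apply, fg_apply, hs]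
    | ck1_self e =>
      simp only [map_mul, FreeAlgebra.lift_ι_apply, gen]
      ext1 f; ext z
      by_cases h : z.1 = G.r e
      · rw [Module.End.mul_apply, fg_apply, fv_apply, if_pos h, if_pos h, fe_self, ← h]
      · simp [fv_apply, fg_apply, h]
    | ck1_ne e e' h =>
      simp only [map_mul, map_zero, FreeAlgebra.lift_ι_apply, gen]
      ext1 f; ext z
      simp [fg_apply, fe_ne e e' _ _ h]
    | ck2 x A hA hne =>
      simp only [map_sum, map_mul, FreeAlgebra.lift_ι_apply, gen]
      ext1 f; ext z
      rw [LinearMap.sum_apply, Finset.sum_apply, fv_apply]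
      by_cases hz : z.1 = x
      · obtain ⟨e₀, he₀⟩ := hne
        obtain ⟨⟨e, n⟩, rfl⟩ := hsurj z ⟨e₀, hz ▸ (hA _).1 he₀⟩
        rw [Finset.sum_eq_single e]
        · simp [hz, fe_self, fg_apply]
        · intro e' _ he'
          exact fe_ne _ _ _ _ he'.symm
        · intro he
          exact absurd ((hA e).2 ((hs _).symm.trans hz)) he
      · rw [if_neg hz]
        refine (Finset.sum_eq_zero fun e he => fe_zero _ _ _ ?_).symm
        rintro n rfl
        exact hz ((hs _).trans ((hA e).1 he))
    | one =>
      simp only [map_sum, map_one, FreeAlgebra.lift_ι_apply, gen]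
      ext1 f; ext z
      rw [LinearMap.sum_apply, Finset.sum_apply]
      simp [fv_apply]
  intro h
  have h0 := congrArg (RingQuot.liftAlgHom K ⟨FreeAlgebra.lift K gen, hrel⟩) h
  rw [vert, RingQuot.liftAlgHom_mkAlgHom_apply, FreeAlgebra.lift_ι_apply, map_zero] at h0
  have h1 : fv x (fun _ => 1) (x, 0) = 0 := by
    have := congrArg (fun T : Module.End K (V × ℕ → K) => T (fun _ => 1) (x, 0)) h0
    exact this
  rw [fv_apply, if_pos rfl] at h1
  exact one_ne_zero h1

end Representation

/-- A cycle with an exit yields infinitely many orthogonal idempotents. -/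
theorem exists_orthogonalIdempotents (K : Type w) [Field K] {V : Type u} {E : Type v} [Fintype V]
    [Finite E] (G : DirectedGraph V E) (h : ∃ c : List E, G.IsCycle c ∧ G.HasExit c) :
    ∃ ψ : ℕ → LeavittPathAlgebra K G, OrthogonalIdempotents ψ ∧ ∀ i, ψ i ≠ 0 := by
  obtain ⟨c, hc, e, he, f, hf, hne⟩ := h
  obtain ⟨a, b, hba, hxa, hay, hbx, hyb⟩ :=
    exists_mul_eq_vert_of_reflTransGen (K := K) (hc.reflTransGen he)
  obtain ⟨hψ, hcut⟩ := orthogonalIdempotents_pow_mul_sub_mul_pow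
    (x := vert K G (G.s e)) (α := edge K G e * a) (β := b * ghost K G e)
    (by rw [mul_assoc, ← mul_assoc (ghost K G e), ghost_mul_edge_self, hxa, hba])
    (by rw [← mul_assoc, vert_mul_edge]) (by rw [mul_assoc, hay])
    (by rw [mul_assoc, ghost_mul_vert]) (by rw [← mul_assoc, hyb])
  refine ⟨_, hψ, fun i hi => vert_ne_zero K G (G.r f) ?_⟩
  have h0 := hcut i
  rw [show _ * _ * _ = _ from hi, mul_zero, zero_mul] at h0
  -- The path `α` begins with `e ≠ f`, so `f*` kills `αβ`.
  calc vert K G (G.r f)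
      = ghost K G f * (vert K G (G.s e) - edge K G e * a * (b * ghost K G e)) * edge K G f := by
        rw [mul_sub, ← hf, ghost_mul_vert, mul_assoc (edge K G e), ← mul_assoc (ghost K G f),
          ghost_mul_edge_of_ne hne, zero_mul, sub_zero, ghost_mul_edge_self]
    _ = 0 := by rw [← h0, mul_zero, zero_mul]

end LeavittPathAlgebra

/-! ### Systems of matrix units -/

/-- The idempotent `p` is a sum `∑ aᵢ bᵢ` where `bᵢ aⱼ` is `0` for `i ≠ j` and belongs to the family
`ε` for `i = j`. -/
def HasMatrixUnits {R W : Type*} [Ring R] (ε : W → R) (p : R) : Prop :=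
  ∃ (n : ℕ) (a b : Fin n → R) (τ : Fin n → W), ∑ i, a i * b i = p ∧
    (∀ i j, b i * a j = if i = j then ε (τ i) else 0) ∧ (∀ i, ε (τ i) * b i = b i) ∧
    ∀ i, a i * ε (τ i) = a i

namespace HasMatrixUnits

variable {R W : Type*} [Ring R] {ε : W → R}

theorem of_fintype {ι : Type*} [Fintype ι] [DecidableEq ι] {p : R} (a b : ι → R) (τ : ι → W)
    (hsum : ∑ i, a i * b i = p) (hba : ∀ i j, b i * a j = if i = j then ε (τ i) else 0)
    (hεb : ∀ i, ε (τ i) * b i = b i) (haε : ∀ i, a i * ε (τ i) = a i) : HasMatrixUnits ε p := by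
  let φ := (Fintype.equivFin ι).symm
  refine ⟨Fintype.card ι, a ∘ φ, b ∘ φ, τ ∘ φ, ?_, fun i j => ?_, fun i => hεb _, fun i => haε _⟩
  · rw [← hsum]
    exact Equiv.sum_comp φ fun i => a i * b i
  · simp only [Function.comp_apply, hba, φ.injective.eq_iff]

theorem of_mul_eq {a b p : R} {w : W} (hab : a * b = p) (hba : b * a = ε w) (hεb : ε w * b = b)
    (haε : a * ε w = a) : HasMatrixUnits ε p :=
  ⟨1, fun _ => a, fun _ => b, fun _ => w, by simpa using hab,
    fun i j => by rw [if_pos (Subsingleton.elim i j), hba], fun _ => hεb, fun _ => haε⟩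

/-- The units of each `p j` are transported along `c j` and `d j` and then collected over all `j`.
This serves both for (CK2), with `c = e` and `d = e*`, and for splitting `1` into vertices. -/
theorem sum {J : Type*} [Fintype J] {q : R} (c d p : J → R) (hsum : ∑ j, c j * d j = q)
    (hdc : ∀ j, d j * c j = p j) (hdc' : ∀ j k, j ≠ k → d j * c k = 0)
    (hcp : ∀ j, c j * p j = c j) (hp : ∀ j, HasMatrixUnits ε (p j)) : HasMatrixUnits ε q := by
  classical
  choose n a b τ hab hba hεb haε using hp
  have hpa : ∀ j i, p j * a j i = a j i := by
    intro j i
    rw [← hab, Finset.sum_mul, Finset.sum_eq_single i]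
    · rw [mul_assoc, hba, if_pos rfl, haε]
    · intro k _ hk
      rw [mul_assoc, hba, if_neg hk, mul_zero]
    · simp
  refine of_fintype (ι := Σ j, Fin (n j)) (fun x => c x.1 * a x.1 x.2) (fun x => b x.1 x.2 * d x.1)
    (fun x => τ x.1 x.2) ?_ ?_ ?_ ?_
  · rw [Fintype.sum_sigma, ← hsum]
    refine Finset.sum_congr rfl fun j _ => ?_
    rw [← hcp j, ← hab, Finset.mul_sum, Finset.sum_mul]
    simp only [mul_assoc]
  · rintro ⟨j, i⟩ ⟨k, l⟩
    simp only
    rw [mul_assoc, ← mul_assoc (d j)]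
    by_cases hjk : j = k
    · subst hjk
      rw [hdc, hpa, hba]
      simp
    · rw [hdc' _ _ hjk, zero_mul, mul_zero, if_neg]
      intro h
      exact hjk (congrArg Sigma.fst h)
  · intro x
    rw [← mul_assoc, hεb]
  · intro x
    rw [mul_assoc, haε]

end HasMatrixUnits

/-! ### The unit that rotates the cycles -/

namespace LeavittPathAlgebra

/-- A unit of the Leavitt path algebra that conjugates the vertices by a permutation, fixing the
noncyclic ones, and from which the edges at cyclic vertices and their ghosts are obtained. -/
structure Rotation (K : Type w) [Field K] {V : Type u} {E : Type v} [Fintype V]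
    (G : DirectedGraph V E) where
  /-- the unit -/
  unit : (LeavittPathAlgebra K G)ˣ
  /-- the permutation -/
  perm : Equiv.Perm V
  vert_mul_unit : ∀ x, vert K G x * unit = unit * vert K G (perm x)
  perm_eq_self : ∀ x, ¬ G.IsCyclic x → perm x = x
  edge_eq : ∀ e, G.IsCyclic (G.s e) → edge K G e = vert K G (G.s e) * unit
  ghost_eq : ∀ e, G.IsCyclic (G.s e) →
    ghost K G e = (unit⁻¹ : (LeavittPathAlgebra K G)ˣ) * vert K G (G.s e)
  r_eq : ∀ e, G.IsCyclic (G.s e) → G.r e = perm (G.s e)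

open Classical in
-- With `U`, `D`, `P` the sums of the edges at cyclic vertices, of their ghosts, and of the cyclic
-- vertices, `U` and `D` are mutually inverse in the corner of `P`. Adding `1 - P` to both makes
-- them inverse in the whole algebra.
theorem nonempty_rotation (K : Type w) [Field K] {V : Type u} {E : Type v} [Fintype V]
    {G : DirectedGraph V E} (hG : G.NoExit) : Nonempty (Rotation K G) := by
  obtain ⟨ε, π, hs, hr⟩ := hG.exists_perm
  have hedge : ∀ e (h : G.IsCyclic (G.s e)), e = ε ⟨G.s e, h⟩ := fun e h =>
    (hG e _ h (hs ⟨G.s e, h⟩)).symm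
  have hinj : ∀ x y, x ≠ y → (π x : V) ≠ π y := fun x y h h' => h (π.injective (Subtype.ext h'))
  set U := ∑ x, edge K G (ε x) with hU
  set D := ∑ x, ghost K G (ε x) with hD
  set P := ∑ x : {x // G.IsCyclic x}, vert K G x with hP
  have hP' : P = ∑ x, vert K G (π x) := (Equiv.sum_comp π fun x => vert K G x).symm
  have vU : ∀ x : {x // G.IsCyclic x}, vert K G x * U = edge K G (ε x) := by
    intro x
    rw [hU, Finset.mul_sum, Finset.sum_eq_single x]
    · rw [← hs x, vert_mul_edge]
    · intro y _ hy
      exact vert_mul_edge_of_ne fun h => hy (Subtype.ext ((hs y).symm.trans h))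
    · simp
  have vU' : ∀ x, ¬ G.IsCyclic x → vert K G x * U = 0 := by
    intro x hx
    rw [hU, Finset.mul_sum]
    refine Finset.sum_eq_zero fun y _ => vert_mul_edge_of_ne fun h => hx ?_
    rw [← h, hs]
    exact y.2
  have Uv : ∀ x, U * vert K G (π x) = edge K G (ε x) := by
    intro x
    rw [hU, Finset.sum_mul, Finset.sum_eq_single x]
    · rw [← hr x, edge_mul_vert]
    · intro y _ hy
      refine edge_mul_vert_of_ne ?_
      rw [hr]
      exact hinj _ _ hy
    · simp
  have Uv' : ∀ x, ¬ G.IsCyclic x → U * vert K G x = 0 := by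
    intro x hx
    rw [hU, Finset.sum_mul]
    refine Finset.sum_eq_zero fun y _ => edge_mul_vert_of_ne fun h => hx ?_
    rw [← h, hr]
    exact (π y).2
  have Dv : ∀ x : {x // G.IsCyclic x}, D * vert K G x = ghost K G (ε x) := by
    intro x
    rw [hD, Finset.sum_mul, Finset.sum_eq_single x]
    · rw [← hs x, ghost_mul_vert]
    · intro y _ hy
      exact ghost_mul_vert_of_ne fun h => hy (Subtype.ext ((hs y).symm.trans h))
    · simp
  have vD : ∀ x, vert K G (π x) * D = ghost K G (ε x) := by
    intro x
    rw [hD, Finset.mul_sum, Finset.sum_eq_single x]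
    · rw [← hr x, vert_mul_ghost]
    · intro y _ hy
      rw [← vert_mul_ghost, hr, ← mul_assoc, vert_mul_of_ne (hinj _ _ hy.symm), zero_mul]
    · simp
  have vP : ∀ x : {x // G.IsCyclic x}, vert K G x * P = vert K G x := by
    intro x
    rw [hP, Finset.mul_sum, Finset.sum_eq_single x, vert_mul_self]
    · intro y _ hy
      exact vert_mul_of_ne fun h => hy (Subtype.ext h.symm)
    · simp
  have Pv : ∀ x : {x // G.IsCyclic x}, P * vert K G x = vert K G x := by
    intro x
    rw [hP, Finset.sum_mul, Finset.sum_eq_single x, vert_mul_self]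
    · intro y _ hy
      exact vert_mul_of_ne fun h => hy (Subtype.ext h)
    · simp
  have vP' : ∀ x, ¬ G.IsCyclic x → vert K G x * P = 0 := by
    intro x hx
    rw [hP, Finset.mul_sum]
    exact Finset.sum_eq_zero fun y _ => vert_mul_of_ne fun h => hx (h ▸ y.2)
  have Pv' : ∀ x, ¬ G.IsCyclic x → P * vert K G x = 0 := by
    intro x hx
    rw [hP, Finset.sum_mul]
    exact Finset.sum_eq_zero fun y _ => vert_mul_of_ne fun h => hx (h ▸ y.2)
  have PP : P * P = P := by
    conv_lhs => enter [2]; rw [hP]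
    rw [Finset.mul_sum]
    exact Finset.sum_congr rfl fun x _ => Pv x
  have PU : P * U = U := by
    rw [hP, Finset.sum_mul]
    exact Finset.sum_congr rfl fun x _ => vU x
  have UP : U * P = U := by
    rw [hP', Finset.mul_sum]
    exact Finset.sum_congr rfl fun x _ => Uv x
  have DP : D * P = D := by
    rw [hP, Finset.mul_sum]
    exact Finset.sum_congr rfl fun x _ => Dv x
  have PD : P * D = D := by
    rw [hP', Finset.sum_mul]
    exact Finset.sum_congr rfl fun x _ => vD x
  -- (CK2) has a single summand at a cyclic vertex. The reverse product below needs (CK1) and that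
  -- `π` is a permutation.
  have UD : U * D = P := by
    rw [hU, Finset.sum_mul, hP]
    refine Finset.sum_congr rfl fun x _ => ?_
    rw [← edge_mul_vert, mul_assoc, hr, vD, vert_eq_sum (x : V) {ε x} (fun e => ?_) (by simp),
      Finset.sum_singleton]
    rw [Finset.mem_singleton]
    exact ⟨fun h => h ▸ hs x, fun h => hG _ _ ((hs x).symm ▸ x.2) (h.trans (hs x).symm)⟩
  have DU : D * U = P := by
    rw [hD, Finset.sum_mul, hP']
    refine Finset.sum_congr rfl fun x _ => ?_
    rw [← ghost_mul_vert, mul_assoc, hs, vU, ghost_mul_edge_self, hr]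
  refine ⟨⟨⟨U + (1 - P), D + (1 - P), ?_, ?_⟩, π.ofSubtype, ?_, ?_, ?_, ?_, ?_⟩⟩
  · simp only [mul_add, add_mul, mul_sub, sub_mul, mul_one, one_mul, UD, UP, PD, PP]
    abel
  · simp only [mul_add, add_mul, mul_sub, sub_mul, mul_one, one_mul, DU, DP, PU, PP]
    abel
  · intro x
    simp only [mul_add, add_mul, mul_sub, sub_mul, mul_one, one_mul]
    by_cases hx : G.IsCyclic x
    · rw [Equiv.Perm.ofSubtype_apply_of_mem π hx, vU ⟨x, hx⟩, vP ⟨x, hx⟩, Uv, Pv, sub_self,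
        sub_self]
    · rw [Equiv.Perm.ofSubtype_apply_of_not_mem π hx, vU' x hx, vP' x hx, Uv' x hx, Pv' x hx]
  · exact fun x hx => Equiv.Perm.ofSubtype_apply_of_not_mem π hx
  · intro e he
    simp only [mul_add, mul_sub, mul_one]
    rw [vU ⟨_, he⟩, vP ⟨_, he⟩, sub_self, add_zero, ← hedge]
  · intro e he
    simp only [Units.inv_mk, add_mul, sub_mul, one_mul]
    rw [Dv ⟨_, he⟩, Pv ⟨_, he⟩, sub_self, add_zero, ← hedge]
  · intro e he
    rw [Equiv.Perm.ofSubtype_apply_of_mem π he, ← hr, ← hedge]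

end LeavittPathAlgebra

/-- A vertex is terminal if it is cyclic or a sink. -/
def DirectedGraph.IsTerminal {V : Type u} {E : Type v} (G : DirectedGraph V E) (x : V) : Prop :=
  G.IsCyclic x ∨ ∀ e, G.s e ≠ x

theorem DirectedGraph.IsTerminal.isCyclic {V : Type u} {E : Type v} {G : DirectedGraph V E} {e : E}
    (h : G.IsTerminal (G.s e)) : G.IsCyclic (G.s e) :=
  h.resolve_right fun h => h e rfl

/-! ### Corners at terminal vertices -/

namespace LeavittPathAlgebra.Rotation

variable {K : Type w} [Field K] {V : Type u} {E : Type v} [Fintype V] {G : DirectedGraph V E}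
  (S : Rotation K G)

theorem isTerminal_zpow {x : V} (hx : G.IsTerminal x) (n : ℤ) :
    G.IsTerminal ((S.perm ^ n) x) := by
  by_cases hc : G.IsCyclic x
  · left
    by_contra h
    have h1 := Equiv.Perm.zpow_apply_eq_self_of_apply_eq_self (S.perm_eq_self _ h) (-n)
    rw [← Equiv.Perm.mul_apply, ← zpow_add, neg_add_cancel, zpow_zero, Equiv.Perm.one_apply] at h1
    exact h (h1 ▸ hc)
  · rwa [Equiv.Perm.zpow_apply_eq_self_of_apply_eq_self (S.perm_eq_self _ hc) n]

theorem vert_mul_inv_unit (x : V) :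
    vert K G (S.perm x) * (S.unit⁻¹ : (LeavittPathAlgebra K G)ˣ) =
      (S.unit⁻¹ : (LeavittPathAlgebra K G)ˣ) * vert K G x := by
  rw [Units.mul_inv_eq_iff_eq_mul, mul_assoc, S.vert_mul_unit, Units.inv_mul_cancel_left]

theorem vert_mul_zpow (x : V) (n : ℤ) :
    vert K G x * (S.unit ^ n : (LeavittPathAlgebra K G)ˣ) =
      (S.unit ^ n : (LeavittPathAlgebra K G)ˣ) * vert K G ((S.perm ^ n) x) := by
  induction n using Int.induction_on with
  | zero => simp
  | succ n ih =>
    rw [zpow_add_one, Units.val_mul, ← mul_assoc, ih, mul_assoc, S.vert_mul_unit, add_comm,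
      zpow_one_add, Equiv.Perm.mul_apply, mul_assoc]
  | pred n ih =>
    have h : (S.perm ^ (-(n : ℤ))) x = S.perm ((S.perm ^ (-(n : ℤ) - 1)) x) := by
      rw [← Equiv.Perm.mul_apply, ← zpow_one_add, add_sub_cancel]
    rw [zpow_sub_one, Units.val_mul, ← mul_assoc, ih, mul_assoc, h, S.vert_mul_inv_unit, mul_assoc]

theorem vert_mul_zpow_mul_vert (x y : V) (n : ℤ) :
    vert K G x * (S.unit ^ n : (LeavittPathAlgebra K G)ˣ) * vert K G y =
      open Classical in
      if (S.perm ^ n) x = y then vert K G x * (S.unit ^ n : (LeavittPathAlgebra K G)ˣ) else 0 := by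
  rw [S.vert_mul_zpow, mul_assoc]
  split_ifs with h
  · rw [h, vert_mul_self]
  · rw [vert_mul_of_ne h, mul_zero]

variable (K G) in
/-- The products of vertices and ghost edges. -/
def ghostMonoid : Submonoid (LeavittPathAlgebra K G) :=
  Submonoid.closure (Set.range (vert K G) ∪ Set.range (ghost K G))

theorem vert_mem_ghostMonoid (x : V) : vert K G x ∈ ghostMonoid K G :=
  Submonoid.subset_closure (.inl ⟨x, rfl⟩)

theorem ghost_mem_ghostMonoid (e : E) : ghost K G e ∈ ghostMonoid K G :=
  Submonoid.subset_closure (.inr ⟨e, rfl⟩)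

/-- The right ideal generated by a terminal vertex `x` is spanned by the elements `x uⁿ m` with
`m` a product of vertices and ghost edges. -/
theorem vert_mul_mem_span {x : V} (hx : G.IsTerminal x) (a : LeavittPathAlgebra K G) :
    vert K G x * a ∈ Submodule.span K {y | ∃ (n : ℤ), ∃ m ∈ ghostMonoid K G,
      y = vert K G x * (S.unit ^ n : (LeavittPathAlgebra K G)ˣ) * m} := by
  set W := Submodule.span K {y | ∃ (n : ℤ), ∃ m ∈ ghostMonoid K G,
      y = vert K G x * (S.unit ^ n : (LeavittPathAlgebra K G)ˣ) * m} with hW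
  -- Only right multiplication by an edge needs an argument. A ghost at the end of `m` cancels the
  -- edge or kills it. Once `m` is used up, the edge starts at a terminal vertex, which is then
  -- cyclic, and becomes one more factor `u`.
  have hedge : ∀ m ∈ ghostMonoid K G, ∀ (n : ℤ) (e : E),
      vert K G x * (S.unit ^ n : (LeavittPathAlgebra K G)ˣ) * m * edge K G e ∈ W := by
    intro m hm
    induction hm using Submonoid.closure_induction_right with
    | one =>
      intro n e
      by_cases he : G.s e = (S.perm ^ n) x
      · have hc := DirectedGraph.IsTerminal.isCyclic (he ▸ S.isTerminal_zpow hx n)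
        refine Submodule.subset_span ⟨n + 1, 1, one_mem _, ?_⟩
        rw [mul_one, mul_one, S.edge_eq e hc, ← mul_assoc, S.vert_mul_zpow_mul_vert, if_pos he.symm,
          zpow_add_one, Units.val_mul, mul_assoc]
      · rw [mul_one, S.vert_mul_zpow, mul_assoc, vert_mul_edge_of_ne he, mul_zero]
        exact W.zero_mem
    | mul_right m hm y hy ih =>
      intro n e
      rcases hy with ⟨z, rfl⟩ | ⟨f, rfl⟩
      · by_cases he : G.s e = z
        · rw [← mul_assoc, mul_assoc, ← he, vert_mul_edge]
          exact ih n e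
        · rw [← mul_assoc, mul_assoc, vert_mul_edge_of_ne he, mul_zero]
          exact W.zero_mem
      · by_cases he : f = e
        · rw [← mul_assoc, mul_assoc, ← he, ghost_mul_edge_self]
          exact Submodule.subset_span
            ⟨n, m * vert K G (G.r f), mul_mem hm (vert_mem_ghostMonoid _), mul_assoc _ _ _⟩
        · rw [← mul_assoc, mul_assoc, ghost_mul_edge_of_ne he, mul_zero]
          exact W.zero_mem
  have hright : ∀ b : LeavittPathAlgebra K G, (∀ (n : ℤ), ∀ m ∈ ghostMonoid K G,
      vert K G x * (S.unit ^ n : (LeavittPathAlgebra K G)ˣ) * m * b ∈ W) →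
      ∀ y ∈ W, y * b ∈ W := by
    intro b hb y hy
    have hle : W ≤ W.comap (LinearMap.mulRight K b) := by
      conv_lhs => rw [hW]
      rw [Submodule.span_le]
      rintro _ ⟨n, m, hm, rfl⟩
      exact hb n m hm
    exact hle hy
  refine mul_mem_of_forall_generator W (fun y hy z => hright _ ?_ y hy)
    (fun y hy e => hright _ (fun n m hm => hedge m hm n e) y hy)
    (fun y hy e => hright _ ?_ y hy) ?_ a
  · intro n m hm
    exact Submodule.subset_span ⟨n, _, mul_mem hm (vert_mem_ghostMonoid z), mul_assoc _ _ _⟩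
  · intro n m hm
    exact Submodule.subset_span ⟨n, _, mul_mem hm (ghost_mem_ghostMonoid e), mul_assoc _ _ _⟩
  · exact Submodule.subset_span ⟨0, 1, one_mem _, by simp⟩

/-- A ghost `f*` meeting a terminal `y = s(f)` from the left becomes `u⁻¹ y`, since `y` emits `f`
and so is cyclic. Moving `u⁻¹` to the right puts the terminal vertex `perm y` in front of the
remaining factors, whence the induction over all `y`. -/
theorem ghostMonoid_mul_vert {m : LeavittPathAlgebra K G} (hm : m ∈ ghostMonoid K G) {y : V}
    (hy : G.IsTerminal y) : m * vert K G y = 0 ∨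
      ∃ k : ℤ, m * vert K G y = (S.unit ^ k : (LeavittPathAlgebra K G)ˣ) * vert K G y := by
  induction hm using Submonoid.closure_induction_right generalizing y with
  | one => exact .inr ⟨0, by simp⟩
  | mul_right m hm z hz ih =>
    rcases hz with ⟨x, rfl⟩ | ⟨f, rfl⟩
    · by_cases h : x = y
      · rw [h, mul_assoc, vert_mul_self]
        exact ih hy
      · rw [mul_assoc, vert_mul_of_ne h, mul_zero]
        exact .inl rfl
    · by_cases h : G.s f = y
      · subst h
        have hpy := S.isTerminal_zpow hy 1
        rw [zpow_one] at hpy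
        rw [mul_assoc, ghost_mul_vert, S.ghost_eq f hy.isCyclic, ← S.vert_mul_inv_unit, ← mul_assoc]
        rcases ih hpy with h0 | ⟨k, hk⟩
        · rw [h0, zero_mul]
          exact .inl rfl
        · refine .inr ⟨k - 1, ?_⟩
          rw [hk, mul_assoc, S.vert_mul_inv_unit, zpow_sub_one, Units.val_mul, mul_assoc]
      · rw [mul_assoc, ghost_mul_vert_of_ne h, mul_zero]
        exact .inl rfl

/-- The corner between terminal vertices `x` and `y` is spanned by the elements `x uⁿ y`. -/
theorem vert_mul_mul_vert_mem_span {x y : V} (hx : G.IsTerminal x) (hy : G.IsTerminal y)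
    (a : LeavittPathAlgebra K G) : vert K G x * a * vert K G y ∈
      Submodule.span K (Set.range fun n : ℤ =>
        vert K G x * (S.unit ^ n : (LeavittPathAlgebra K G)ˣ) * vert K G y) := by
  set W := Submodule.span K (Set.range fun n : ℤ =>
    vert K G x * (S.unit ^ n : (LeavittPathAlgebra K G)ˣ) * vert K G y) with hW
  have ha := S.vert_mul_mem_span hx a
  suffices h : _ ≤ W.comap (LinearMap.mulRight K (vert K G y)) from h ha
  rw [Submodule.span_le]
  rintro _ ⟨n, m, hm, rfl⟩
  rw [SetLike.mem_coe, Submodule.mem_comap, LinearMap.mulRight_apply, mul_assoc]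
  rcases S.ghostMonoid_mul_vert hm hy with h | ⟨k, hk⟩
  · rw [h, mul_zero]
    exact W.zero_mem
  · refine Submodule.subset_span ⟨n + k, ?_⟩
    simp only
    rw [hk, zpow_add, Units.val_mul]
    simp only [mul_assoc]

end LeavittPathAlgebra.Rotation

/-! ### Orbits, Laurent polynomials and the conclusion -/

namespace LeavittPathAlgebra.Rotation

open scoped LaurentPolynomial

variable {K : Type w} [Field K] {V : Type u} {E : Type v} [Fintype V] {G : DirectedGraph V E}
  (S : Rotation K G)

/-- A chosen representative of the orbit of `x`. -/
noncomputable def rep (x : V) : V :=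
  Quotient.out (Quotient.mk (Equiv.Perm.SameCycle.setoid S.perm) x)

theorem sameCycle_rep (x : V) : S.perm.SameCycle x (S.rep x) :=
  (Quotient.exact (Quotient.out_eq (Quotient.mk (Equiv.Perm.SameCycle.setoid S.perm) x))).symm

theorem rep_eq_of_sameCycle {x y : V} (h : S.perm.SameCycle x y) : S.rep x = S.rep y :=
  congrArg Quotient.out (Quotient.sound (s := Equiv.Perm.SameCycle.setoid S.perm) h)

/-- The chosen representatives of the orbits of terminal vertices. -/
abbrev Reps : Type u := {x : V // G.IsTerminal x ∧ S.rep x = x}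

/-- The idempotent of a representative. -/
def repVert (x : S.Reps) : LeavittPathAlgebra K G := vert K G x.1

theorem repVert_mul_mul_repVert {x y : S.Reps} (h : x ≠ y) (a : LeavittPathAlgebra K G) :
    S.repVert x * a * S.repVert y = 0 := by
  have ha := S.vert_mul_mul_vert_mem_span x.2.1 y.2.1 a
  rw [← Submodule.mem_bot K]
  refine Submodule.span_le.2 ?_ ha
  rintro _ ⟨n, rfl⟩
  simp only [SetLike.mem_coe, Submodule.mem_bot]
  rw [S.vert_mul_zpow_mul_vert, if_neg]
  intro hn
  have := S.rep_eq_of_sameCycle ⟨n, hn⟩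
  rw [x.2.2, y.2.2] at this
  exact h (Subtype.ext this)

/-- The smallest power of the unit that commutes with `x`. -/
noncomputable def periodUnit (x : V) : (LeavittPathAlgebra K G)ˣ :=
  S.unit ^ Function.minimalPeriod (S.perm • ·) x

/-- Evaluation of Laurent polynomials at `S.periodUnit x`. -/
noncomputable def laurentEval (x : V) : K[T;T⁻¹] →ₐ[K] LeavittPathAlgebra K G :=
  AddMonoidAlgebra.lift K _ ℤ ((Units.coeHom _).comp (zpowersHom _ (S.periodUnit x)))

theorem laurentEval_single (x : V) (n : ℤ) (c : K) :
    S.laurentEval x (AddMonoidAlgebra.single n c) =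
      c • ((S.unit ^ (Function.minimalPeriod (S.perm • ·) x * n : ℤ) :
        (LeavittPathAlgebra K G)ˣ) : LeavittPathAlgebra K G) := by
  rw [laurentEval, AddMonoidAlgebra.lift_single, zpow_mul, zpow_natCast]
  rfl

theorem laurentEval_mul_vert (x : V) (f : K[T;T⁻¹]) :
    S.laurentEval x f * vert K G x = vert K G x * S.laurentEval x f := by
  induction f using AddMonoidAlgebra.induction_linear with
  | zero => simp
  | add f g hf hg => rw [map_add, add_mul, mul_add, hf, hg]
  | single n c =>
    rw [laurentEval_single, smul_mul_assoc, mul_smul_comm, S.vert_mul_zpow]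
    have h : S.perm ^ (Function.minimalPeriod (S.perm • ·) x * n : ℤ) • x = x :=
      MulAction.zpow_smul_eq_iff_minimalPeriod_dvd.2 (dvd_mul_right _ _)
    rw [Equiv.Perm.smul_def] at h
    rw [h]

/-- The element `x uⁿ x` survives only if `permⁿ` fixes `x`, that is, if the period divides `n`.
Surjectivity onto the corner is enough; at a sink the evaluation has a kernel. -/
theorem exists_repVert_mul_mul_repVert_eq (x : S.Reps) (a : LeavittPathAlgebra K G) :
    ∃ f, S.repVert x * a * S.repVert x = S.laurentEval x.1 f * S.repVert x := by
  have ha := S.vert_mul_mul_vert_mem_span x.2.1 x.2.1 a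
  suffices h : _ ≤ LinearMap.range
      (LinearMap.mulRight K (S.repVert x) ∘ₗ (S.laurentEval x.1).toLinearMap) by
    obtain ⟨f, hf⟩ := h ha
    exact ⟨f, hf.symm⟩
  rw [Submodule.span_le]
  rintro _ ⟨n, rfl⟩
  simp only
  rw [S.vert_mul_zpow_mul_vert]
  split_ifs with hn
  · obtain ⟨k, hk⟩ := MulAction.zpow_smul_eq_iff_minimalPeriod_dvd.1
      ((Equiv.Perm.smul_def _ _).trans hn)
    refine ⟨AddMonoidAlgebra.single k 1, ?_⟩
    rw [LinearMap.comp_apply, AlgHom.toLinearMap_apply, laurentEval_single, one_smul,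
      LinearMap.mulRight_apply, ← hk, S.vert_mul_zpow, hn]
    rfl
  · exact Submodule.zero_mem _

/-- A power of `u` conjugates `x` into the representative of its orbit. -/
theorem hasMatrixUnits_of_isTerminal {x : V} (hx : G.IsTerminal x) :
    HasMatrixUnits S.repVert (vert K G x) := by
  obtain ⟨n, hn⟩ := S.sameCycle_rep x
  have hrep : S.rep (S.rep x) = S.rep x := (S.rep_eq_of_sameCycle (S.sameCycle_rep x)).symm
  let y : S.Reps := ⟨S.rep x, hn ▸ S.isTerminal_zpow hx n, hrep⟩
  have hy : vert K G x * (S.unit ^ n : (LeavittPathAlgebra K G)ˣ) =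
      (S.unit ^ n : (LeavittPathAlgebra K G)ˣ) * S.repVert y := by
    rw [S.vert_mul_zpow, hn]
    rfl
  have hyy : S.repVert y * S.repVert y = S.repVert y := vert_mul_self _
  refine .of_mul_eq (a := (S.unit ^ n : (LeavittPathAlgebra K G)ˣ) * S.repVert y)
    (b := S.repVert y * ((S.unit ^ n)⁻¹ : (LeavittPathAlgebra K G)ˣ)) (w := y) ?_ ?_ ?_ ?_
  · rw [mul_assoc, ← mul_assoc (S.repVert y), hyy, ← mul_assoc, ← hy, Units.mul_inv_cancel_right]
  · rw [mul_assoc, Units.inv_mul_cancel_left, hyy]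
  · rw [← mul_assoc, hyy]
  · rw [mul_assoc, hyy]

/-- Well-founded induction along the edges leaving noncyclic vertices: (CK2) reduces a nonterminal
vertex to the ranges of its edges. -/
theorem hasMatrixUnits_vert [Finite E] (x : V) : HasMatrixUnits S.repVert (vert K G x) := by
  classical
  have := Fintype.ofFinite E
  induction x using DirectedGraph.wellFounded_adj_of_not_isCyclic (G := G) |>.induction with
  | _ x ih =>
    by_cases hx : G.IsTerminal x
    · exact S.hasMatrixUnits_of_isTerminal hx
    · rw [DirectedGraph.IsTerminal, not_or, not_forall] at hx
      obtain ⟨hc, e₀, he₀⟩ := hx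
      rw [not_not] at he₀
      refine .sum (J := {e // G.s e = x}) (fun e => edge K G e) (fun e => ghost K G e)
        (fun e => vert K G (G.r e)) ?_ (fun e => ghost_mul_edge_self _)
        (fun e f hef => ghost_mul_edge_of_ne fun h => hef (Subtype.ext h))
        (fun e => edge_mul_vert _) (fun e => ih _ ⟨hc, e, e.2, rfl⟩)
      rw [vert_eq_sum x (Finset.univ.filter fun e => G.s e = x) (by simp) ⟨e₀, by simpa using he₀⟩]
      exact (Finset.sum_subtype _ (by simp) fun e => edge K G e * ghost K G e).symm

theorem isLeftRightPIR (S : Rotation K G) [Finite E] : IsLeftRightPIR (LeavittPathAlgebra K G) := by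
  obtain ⟨n, a, b, τ, hsum, hba, hεb, haε⟩ : HasMatrixUnits S.repVert 1 :=
    .sum (vert K G) (vert K G) (vert K G)
      (by rw [one_eq_sum_vert K G]; exact Finset.sum_congr rfl fun x _ => vert_mul_self x)
      vert_mul_self (fun x y h => vert_mul_of_ne h) vert_mul_self S.hasMatrixUnits_vert
  exact .of_corners (A := K[T;T⁻¹]) a b τ S.repVert (fun x => (S.laurentEval x.1).toRingHom)
    hsum hba hεb haε (fun x => S.laurentEval_mul_vert x.1) S.exists_repVert_mul_mul_repVert_eq
    fun x y a h => S.repVert_mul_mul_repVert h a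

end LeavittPathAlgebra.Rotation

theorem mainTheorem3 (K : Type w) [Field K] {V : Type u} {E : Type v} [Fintype V] [Finite E]
    (G : DirectedGraph V E) :
    (IsLeftRightPIR (LeavittPathAlgebra K G) ↔ ∀ c : List E, G.IsCycle c → ¬ G.HasExit c) ∧
    ((∃ c : List E, G.IsCycle c ∧ G.HasExit c) →
      ∃ ψ : ℕ → LeavittPathAlgebra K G,
        OrthogonalIdempotents ψ ∧ (∀ i, ψ i ≠ 0) ∧ ¬ (Ideal.span (Set.range ψ)).FG) := by
  have key : (∃ c : List E, G.IsCycle c ∧ G.HasExit c) →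
      ∃ ψ : ℕ → LeavittPathAlgebra K G,
        OrthogonalIdempotents ψ ∧ (∀ i, ψ i ≠ 0) ∧ ¬ (Ideal.span (Set.range ψ)).FG := by
    intro h
    obtain ⟨ψ, hψ, hne⟩ := LeavittPathAlgebra.exists_orthogonalIdempotents K G h
    exact ⟨ψ, hψ, hne, Ideal.not_fg_span_range_of_orthogonalIdempotents hψ hne⟩
  refine ⟨⟨fun hR c hc he => ?_, fun h => ?_⟩, key⟩
  · obtain ⟨ψ, -, -, hfg⟩ := key ⟨c, hc, he⟩
    -- Principal left ideals alone already exclude exits.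
    exact hfg (hR.left _).fg
  · obtain ⟨S⟩ := LeavittPathAlgebra.nonempty_rotation K (DirectedGraph.noExit_of_forall_isCycle h)
    exact S.isLeftRightPIR
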